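/- Let $n\in\mathbb{N}$ and equip $\mathbb{R}^{n+2}$, with Cartesian coordinates $y^0,\dots,y^{n+1}$, with the constant metric $\eta=\mathrm{diag}(+,-,\dots,-,+)$ (the entries of index $0$ and $n+1$ are $+1$, all others $-1$). Put $c(y)=\tfrac12\eta(y,y)$. Let $f$ be a real smooth function on an open cone $\Omega\subseteq\mathbb{R}^{n+2}$ (stable under $y\mapsto ty$, $t>0$) that is homogeneous of degree $1$: $f(ty)=t f(y)$ for all $t>0$, $y\in\Omega$. Let $$X_f=\{y\in\Omega \mid c(y)=0,\ f(y)=1\},$$ with inclusion $m_f:X_f\to\mathbb{R}^{n+2}$ and induced metric $\eta_f=m_f{}^*\eta$, and define the vector fields $$D=\sharp_\eta dc=y^\alpha\partial_\alpha,\qquad F=\sharp_\eta df,\qquad E_f=fF-\mathbf{F}^2D,\qquad \mathbf{F}^2=\eta(F,F).$$ Then $X_f$ is an $n$-dimensional smooth submanifold of $\mathbb{R}^{n+2}$ (every point of $X_f$ lies in the image of a smooth local parametrization by an open subset of $\mathbb{R}^n$), $\eta_f$ is non-degenerate, and for every function $\phi$ that is smooth on an open set containing $X_f$, with $\phi_f=\phi\circ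 m_f$, one has on $X_f$ $$m_f{}^*(\nabla^{\eta}d\phi)=\nabla^{f}d_f\phi_f+m_f{}^*\bigl[D(\phi)\,\nabla^{\eta}df+E_f(\phi)\,\eta\bigr].$$ Here $\nabla^\eta$ and $\nabla^f$ are the Levi-Civita connections of $\eta$ and $\eta_f$, $d_f$ is the exterior derivative on $X_f$, $\nabla d\phi$ denotes the Hessian, $(\nabla d\phi)(u,v)=\langle\nabla_u d\phi,v\rangle$, and $V(\phi)=d\phi(V)$ for a vector field $V$. -/

import Mathlib

open scoped ContDiff

namespace NullCone

/-! ### Pseudo-Riemannian calculus on open subsets of `ℝᵏ`, in coordinates -/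

/-- Partial derivative of a scalar function along the `i`-th coordinate. -/
noncomputable def pd {k : ℕ} (i : Fin k) (h : (Fin k → ℝ) → ℝ) (x : Fin k → ℝ) : ℝ :=
  fderiv ℝ h x (Pi.single i 1)

/-- Christoffel symbols `Γˡᵢⱼ` of the Levi-Civita connection of the metric with components `g`:
`Γˡᵢⱼ = ½ gˡᵐ (∂ᵢ gₘⱼ + ∂ⱼ gₘᵢ - ∂ₘ gᵢⱼ)`. -/
noncomputable def christoffel {k : ℕ} (g : (Fin k → ℝ) → Matrix (Fin k) (Fin k) ℝ)
    (x : Fin k → ℝ) (l i j : Fin k) : ℝ :=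
  1 / 2 * ∑ m, (g x)⁻¹ l m *
    (pd i (fun z => g z m j) x + pd j (fun z => g z m i) x - pd m (fun z => g z i j) x)

/-- Levi-Civita covariant derivative of a 1-form `lam`: the number `⟨∇ᵍ_u lam, v⟩` at `x`. -/
noncomputable def covDerivForm {k : ℕ} (g : (Fin k → ℝ) → Matrix (Fin k) (Fin k) ℝ)
    (lam : (Fin k → ℝ) → ((Fin k → ℝ) →L[ℝ] ℝ)) (x u v : Fin k → ℝ) : ℝ :=
  fderiv ℝ lam x u v
    - ∑ l, ∑ i, ∑ j, christoffel g x l i j * u i * v j * lam x (Pi.single l 1)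

/-- The Hessian `(∇ᵍ dφ)(u, v) = ⟨∇ᵍ_u dφ, v⟩` at `x`. -/
noncomputable def hessian {k : ℕ} (g : (Fin k → ℝ) → Matrix (Fin k) (Fin k) ℝ)
    (φ : (Fin k → ℝ) → ℝ) (x u v : Fin k → ℝ) : ℝ :=
  covDerivForm g (fderiv ℝ φ) x u v

/-! ### The ambient space `ℝⁿ⁺²` with `η = diag(+, -, …, -, +)` -/

/-- Diagonal entries of `η`: `+1` for the indices `0` and `n + 1`, `-1` for all the others. -/
noncomputable def etaSign (n : ℕ) (α : Fin (n + 2)) : ℝ :=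
  if α = 0 ∨ α = Fin.last (n + 1) then 1 else -1

/-- The ambient metric as a (constant) matrix of components. -/
noncomputable def etaMatrix (n : ℕ) : Matrix (Fin (n + 2)) (Fin (n + 2)) ℝ :=
  Matrix.diagonal (etaSign n)

/-- The ambient metric as a bilinear form. -/
noncomputable def eta (n : ℕ) (u v : Fin (n + 2) → ℝ) : ℝ :=
  ∑ α, etaSign n α * u α * v α

/-- `c(y) = ½ y_α y^α`. -/
noncomputable def coneFn (n : ℕ) (y : Fin (n + 2) → ℝ) : ℝ := 1 / 2 * eta n y y

/-- The gradient `♯_η dh`, with components `η^{αα} ∂_α h`. -/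
noncomputable def grad (n : ℕ) (h : (Fin (n + 2) → ℝ) → ℝ) (y : Fin (n + 2) → ℝ) :
    Fin (n + 2) → ℝ :=
  fun α => etaSign n α * pd α h y

/-- The dilation field `D = ♯_η dc = y^α ∂_α`. -/
noncomputable def fieldD (n : ℕ) : (Fin (n + 2) → ℝ) → (Fin (n + 2) → ℝ) := grad n (coneFn n)

/-- `F = ♯_η df`. -/
noncomputable def fieldF (n : ℕ) (f : (Fin (n + 2) → ℝ) → ℝ) :
    (Fin (n + 2) → ℝ) → (Fin (n + 2) → ℝ) := grad n f

/-- `E_f = f F - F² D`, with `F² = η(F, F)`. -/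
noncomputable def fieldE (n : ℕ) (f : (Fin (n + 2) → ℝ) → ℝ) (y : Fin (n + 2) → ℝ) :
    Fin (n + 2) → ℝ :=
  f y • fieldF n f y - eta n (fieldF n f y) (fieldF n f y) • fieldD n y

/-- Action `V(φ) = ⟨dφ, V⟩` of a vector field on a function. -/
noncomputable def act {k : ℕ} (V : (Fin k → ℝ) → (Fin k → ℝ)) (φ : (Fin k → ℝ) → ℝ)
    (y : Fin k → ℝ) : ℝ := fderiv ℝ φ y (V y)

/-! ### The submanifold `X_f` -/

/-- `X_f = {c = 0} ∩ {f = 1}`, for a function `f` with domain `Ω`. -/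
def Xf (n : ℕ) (Ω : Set (Fin (n + 2) → ℝ)) (f : (Fin (n + 2) → ℝ) → ℝ) :
    Set (Fin (n + 2) → ℝ) :=
  {y | y ∈ Ω ∧ coneFn n y = 0 ∧ f y = 1}

/-- `x : U → ℝᴺ` is a smooth local parametrization (the inverse of a chart) of the
`n`-dimensional submanifold `X ⊆ ℝᴺ`: a smooth immersion of the open set `U ⊆ ℝⁿ` which is a
homeomorphism onto a relatively open subset of `X`. -/
structure IsLocalParam {n N : ℕ} (X : Set (Fin N → ℝ)) (U : Set (Fin n → ℝ))
    (x : (Fin n → ℝ) → (Fin N → ℝ)) : Prop where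
  isOpen : IsOpen U
  smooth : ContDiffOn ℝ ∞ x U
  immersion : ∀ ξ ∈ U, Function.Injective (fderiv ℝ x ξ)
  embedding : Topology.IsEmbedding (U.domRestrict x)
  image : ∃ V : Set (Fin N → ℝ), IsOpen V ∧ x '' U = X ∩ V

/-- Pull-back along `x` of a field `B` of bilinear forms. If `x` is a local parametrization of
`X`, this is the expression, in the coordinates given by `x`, of the pull-back of `B` to `X`. -/
noncomputable def pullback {n N : ℕ} (x : (Fin n → ℝ) → (Fin N → ℝ))
    (B : (Fin N → ℝ) → (Fin N → ℝ) → (Fin N → ℝ) → ℝ) (ξ a b : Fin n → ℝ) : ℝ :=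
  B (x ξ) (fderiv ℝ x ξ a) (fderiv ℝ x ξ b)

/-- Components of the induced metric (the pull-back of `η`) in the coordinates given by `x`. -/
noncomputable def inducedMetric {n : ℕ} (x : (Fin n → ℝ) → (Fin (n + 2) → ℝ))
    (ξ : Fin n → ℝ) : Matrix (Fin n) (Fin n) ℝ :=
  Matrix.of fun i j => pullback x (fun _ u v => eta n u v) ξ (Pi.single i 1) (Pi.single j 1)

end NullCone

namespace NullCone

open Filter Topology

/-! ### Regular level sets are submanifolds -/

/-! At a point `y` of `X_f` one has `η(D, D) = 2c = 0`, and Euler's identity gives `η(D, F) = f =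
1`. So `D` and `F` span a hyperbolic plane, whatever `η(F, F)` is. Hence `(c, f)` is a submersion
along `X_f`, and the tangent space is the orthogonal complement of that plane, on which `η` is
non-degenerate.

In a parametrization `x`, write `∂²x(a, b) = dx(c) + αD + βF` (`exists_frame_decomposition`; here
`c` is a coordinate vector). The Levi-Civita connection of the induced metric keeps only `dx(c)`, so
the intrinsic Hessian of `φ ∘ x` is the flat one plus `dφ(αD + βF)`
(`hessian_inducedMetric_of_decomposition`). Differentiating the two defining equations twice along
`x` (`fderiv_comp_eq_zero_of_eventually_const`) gives `β = -η(dx a, dx b)` and `α + βF² = -∇df(dx a,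
dx b)`. Substitution produces exactly the terms in `D(φ)` and `E_f(φ)`. -/

theorem exists_continuousLinearEquiv_prod {E G : Type*} [NormedAddCommGroup E] [NormedSpace ℝ E]
    [FiniteDimensional ℝ E] [NormedAddCommGroup G] [NormedSpace ℝ G] [FiniteDimensional ℝ G]
    {n : ℕ} (L : E →L[ℝ] G) (hL : Function.Surjective L)
    (hn : Module.finrank ℝ E = Module.finrank ℝ G + n) :
    ∃ (P : E →L[ℝ] (Fin n → ℝ)) (e : E ≃L[ℝ] G × (Fin n → ℝ)),
      (e : E →L[ℝ] G × (Fin n → ℝ)) = L.prod P := by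
  have hrank := LinearMap.finrank_range_add_finrank_ker (L : E →ₗ[ℝ] G)
  rw [LinearMap.range_eq_top.2 hL, finrank_top] at hrank
  have hker : Module.finrank ℝ (LinearMap.ker (L : E →ₗ[ℝ] G)) = Module.finrank ℝ (Fin n → ℝ) := by
    rw [Module.finrank_fin_fun]; omega
  let ψ := LinearEquiv.ofFinrankEq _ _ hker
  obtain ⟨p, hp⟩ := LinearMap.exists_leftInverse_of_injective
    (LinearMap.ker (L : E →ₗ[ℝ] G)).subtype (Submodule.ker_subtype _)
  let P : E →L[ℝ] (Fin n → ℝ) := LinearMap.toContinuousLinearMap (ψ.toLinearMap ∘ₗ p)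
  have hinj : Function.Injective (L.prod P).toLinearMap := by
    rw [← LinearMap.ker_eq_bot, LinearMap.ker_eq_bot']
    intro v hv
    have h1 : L v = 0 := congrArg Prod.fst hv
    have h2 : ψ (p v) = 0 := congrArg Prod.snd hv
    have h3 : p v = ⟨v, h1⟩ := LinearMap.congr_fun hp ⟨v, h1⟩
    rw [LinearEquiv.map_eq_zero_iff, h3] at h2
    exact congrArg Subtype.val h2
  have hdim : Module.finrank ℝ E = Module.finrank ℝ (G × (Fin n → ℝ)) := by
    rw [Module.finrank_prod, Module.finrank_fin_fun, hn]
  refine ⟨P, (LinearMap.linearEquivOfInjective _ hinj hdim).toContinuousLinearEquiv, ?_⟩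
  ext1 v
  rfl

/-- Inverse function theorem for `Φ = (h, P)`, where `P` restricts to an isomorphism from the kernel
of `dh` at `y` onto `ℝⁿ`. The parametrization is the slice `ξ ↦ Φ⁻¹(h y, ξ)`; its left inverse `P`
makes it both an immersion and an embedding. -/
theorem exists_isLocalParam_of_surjective {n N : ℕ} {G : Type*} [NormedAddCommGroup G]
    [NormedSpace ℝ G] [FiniteDimensional ℝ G] (hN : N = Module.finrank ℝ G + n)
    {Ω : Set (Fin N → ℝ)} (hΩ : IsOpen Ω) {h : (Fin N → ℝ) → G} (hh : ContDiffOn ℝ ∞ h Ω)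
    {y : Fin N → ℝ} (hy : y ∈ Ω) (hsurj : Function.Surjective (fderiv ℝ h y)) :
    ∃ (U : Set (Fin n → ℝ)) (x : (Fin n → ℝ) → (Fin N → ℝ)),
      IsLocalParam {z | z ∈ Ω ∧ h z = h y} U x ∧ y ∈ x '' U := by
  have hh' : ∀ z ∈ Ω, ContDiffAt ℝ ∞ h z := fun z hz => hh.contDiffAt (hΩ.mem_nhds hz)
  obtain ⟨P, e, he⟩ := exists_continuousLinearEquiv_prod (n := n) (fderiv ℝ h y) hsurj
    (by rw [Module.finrank_fin_fun, hN])
  let Φ : (Fin N → ℝ) → G × (Fin n → ℝ) := fun z => (h z, P z)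
  have hΦ : ∀ z ∈ Ω, ContDiffAt ℝ ∞ Φ z := fun z hz => (hh' z hz).prodMk P.contDiff.contDiffAt
  have hdΦ : ∀ z ∈ Ω, HasFDerivAt Φ ((fderiv ℝ h z).prod P) z := fun z hz =>
    ((hh' z hz).differentiableAt (by simp)).hasFDerivAt.prodMk P.hasFDerivAt
  have hey : HasFDerivAt Φ (e : (Fin N → ℝ) →L[ℝ] G × (Fin n → ℝ)) y := by
    rw [he]; exact hdΦ y hy
  -- Restricting to points where `dΦ` is invertible makes the local inverse smooth on its whole
  -- domain, not just at `Φ y`.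
  let S : Set (Fin N → ℝ) := {z ∈ Ω | fderiv ℝ Φ z ∈
    Set.range ((↑) : ((Fin N → ℝ) ≃L[ℝ] G × (Fin n → ℝ)) → _)}
  have hS : IsOpen S := by
    refine ContinuousOn.isOpen_inter_preimage (f := fderiv ℝ Φ) (fun z hz => ?_) hΩ
      ContinuousLinearEquiv.isOpen
    exact ((hΦ z hz).fderiv_right (m := 0) (by simp)).continuousAt.continuousWithinAt
  have hyS : y ∈ S := ⟨hy, e, hey.fderiv.symm⟩
  let Ψ := ((hΦ y hy).toOpenPartialHomeomorph Φ hey (by simp)).restrOpen S hS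
  have hΨ : ∀ z, Ψ z = Φ z := fun z => rfl
  have hsrc : Ψ.source ⊆ S := fun z hz => hz.2
  have hyΨ : y ∈ Ψ.source :=
    ⟨(hΦ y hy).mem_toOpenPartialHomeomorph_source hey (by simp), hyS⟩
  let ι : (Fin n → ℝ) → G × (Fin n → ℝ) := fun ξ => (h y, ξ)
  have hι : ContDiff ℝ ∞ ι := contDiff_const.prodMk contDiff_id
  let x : (Fin n → ℝ) → (Fin N → ℝ) := fun ξ => Ψ.symm (ι ξ)
  let U : Set (Fin n → ℝ) := ι ⁻¹' Ψ.target
  have hU : IsOpen U := Ψ.open_target.preimage hι.continuous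
  have hΦx : ∀ ξ ∈ U, Φ (x ξ) = ι ξ := fun ξ hξ => Ψ.right_inv hξ
  have hPx : ∀ ξ ∈ U, P (x ξ) = ξ := fun ξ hξ => congrArg Prod.snd (hΦx ξ hξ)
  have hxS : ∀ ξ ∈ U, x ξ ∈ Ψ.source := fun ξ hξ => Ψ.map_target hξ
  have hx : ∀ ξ ∈ U, ContDiffAt ℝ ∞ x ξ := by
    intro ξ hξ
    obtain ⟨hzΩ, e', he'⟩ := hsrc (hxS ξ hξ)
    have hd : HasFDerivAt Ψ (e' : (Fin N → ℝ) →L[ℝ] G × (Fin n → ℝ)) (x ξ) := by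
      rw [he']; exact (hdΦ _ hzΩ).differentiableAt.hasFDerivAt
    exact (Ψ.contDiffAt_symm hξ hd (hΦ _ hzΩ)).comp ξ hι.contDiffAt
  have himg : ∀ z ∈ Ψ.source, h z = h y → P z ∈ U ∧ x (P z) = z := by
    intro z hz hzy
    have : ι (P z) = Ψ z := by rw [hΨ]; exact Prod.ext hzy.symm rfl
    refine ⟨?_, ?_⟩
    · change ι (P z) ∈ Ψ.target
      rw [this]; exact Ψ.map_source hz
    · change Ψ.symm (ι (P z)) = z
      rw [this]; exact Ψ.left_inv hz
  refine ⟨U, x, ⟨hU, fun ξ hξ => (hx ξ hξ).contDiffWithinAt, fun ξ hξ => ?_, ?_, Ψ.source,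
    Ψ.open_source, ?_⟩, P y, himg y hyΨ rfl⟩
  · have h1 : HasFDerivAt (fun ζ => P (x ζ)) (P ∘L fderiv ℝ x ξ) ξ :=
      P.hasFDerivAt.comp ξ ((hx ξ hξ).differentiableAt (by simp)).hasFDerivAt
    have h2 : (fun ζ => P (x ζ)) =ᶠ[𝓝 ξ] id := by
      filter_upwards [hU.mem_nhds hξ] with ζ hζ using hPx ζ hζ
    have h3 := h1.unique ((hasFDerivAt_id ξ).congr_of_eventuallyEq h2)
    exact Function.LeftInverse.injective (g := P) fun v => DFunLike.congr_fun h3 v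
  · refine Topology.IsEmbedding.of_comp (g := P) ?_ P.continuous ?_
    · exact continuousOn_iff_continuous_domRestrict.1 fun ξ hξ =>
        (hx ξ hξ).continuousAt.continuousWithinAt
    · have : (P ∘ U.domRestrict x) = ((↑) : U → _) := funext fun ξ => hPx ξ ξ.2
      rw [this]; exact Topology.IsEmbedding.subtypeVal
  · ext z
    constructor
    · rintro ⟨ξ, hξ, rfl⟩
      exact ⟨⟨(hsrc (hxS ξ hξ)).1, congrArg Prod.fst (hΦx ξ hξ)⟩, hxS ξ hξ⟩
    · rintro ⟨⟨_, hz⟩, hzs⟩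
      exact ⟨P z, himg z hzs hz⟩

/-! ### The ambient metric -/

/-- The ambient metric as a continuous bilinear map. -/
noncomputable def etaL (n : ℕ) : (Fin (n + 2) → ℝ) →L[ℝ] (Fin (n + 2) → ℝ) →L[ℝ] ℝ :=
  ∑ α, etaSign n α • (ContinuousLinearMap.proj (R := ℝ) (φ := fun _ : Fin (n + 2) => ℝ) α).smulRight
    (ContinuousLinearMap.proj (R := ℝ) (φ := fun _ : Fin (n + 2) => ℝ) α)

theorem etaL_apply (n : ℕ) (u v : Fin (n + 2) → ℝ) : etaL n u v = eta n u v := by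
  simp [etaL, eta, mul_assoc]

theorem etaSign_mul_self (n : ℕ) (α : Fin (n + 2)) : etaSign n α * etaSign n α = 1 := by
  unfold etaSign; split_ifs <;> norm_num

theorem etaL_comm (n : ℕ) (u v : Fin (n + 2) → ℝ) : etaL n u v = etaL n v u := by
  simp only [etaL_apply, eta]
  exact Finset.sum_congr rfl fun α _ => by ring

theorem etaL_nondegenerate {n : ℕ} {u : Fin (n + 2) → ℝ} (h : ∀ v, etaL n u v = 0) : u = 0 := by
  funext α
  have := h (Pi.single α (etaSign n α))
  rw [etaL_apply, eta, Finset.sum_eq_single α (by simp +contextual) (by simp), Pi.single_eq_same,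
    mul_right_comm, etaSign_mul_self, one_mul] at this
  simpa using this

theorem sum_mul_pd {k : ℕ} (h : (Fin k → ℝ) → ℝ) (y v : Fin k → ℝ) :
    ∑ α, v α * pd α h y = fderiv ℝ h y v := by
  conv_rhs => rw [pi_eq_sum_univ' v]
  simp [pd]

theorem etaL_grad (n : ℕ) (h : (Fin (n + 2) → ℝ) → ℝ) (y v : Fin (n + 2) → ℝ) :
    etaL n (grad n h y) v = fderiv ℝ h y v := by
  rw [etaL_apply, eta, ← sum_mul_pd]
  refine Finset.sum_congr rfl fun α _ => ?_
  rw [grad, ← mul_assoc, etaSign_mul_self]; ring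

theorem hasFDerivAt_coneFn (n : ℕ) (y : Fin (n + 2) → ℝ) :
    HasFDerivAt (coneFn n) (etaL n y) y := by
  have h : HasFDerivAt (fun z => 1 / 2 * etaL n z z) _ y :=
    ((etaL n).hasFDerivAt.clm_apply (hasFDerivAt_id y)).const_mul (1 / 2)
  have h2 : coneFn n = fun z => 1 / 2 * etaL n z z := by
    funext z; rw [coneFn, etaL_apply]
  rw [h2]
  refine h.congr_fderiv ?_
  ext1 v
  simp [etaL_comm n v y]
  ring

theorem fderiv_coneFn (n : ℕ) : fderiv ℝ (coneFn n) = etaL n :=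
  funext fun y => (hasFDerivAt_coneFn n y).fderiv

theorem contDiff_coneFn (n : ℕ) : ContDiff ℝ ∞ (coneFn n) := by
  have h2 : coneFn n = fun z => 1 / 2 * etaL n z z := by
    funext z; rw [coneFn, etaL_apply]
  rw [h2]
  exact contDiff_const.mul ((etaL n).contDiff.clm_apply contDiff_id)

theorem fieldD_eq (n : ℕ) (y : Fin (n + 2) → ℝ) : fieldD n y = y := by
  refine sub_eq_zero.1 (etaL_nondegenerate fun v => ?_)
  rw [map_sub, sub_apply, fieldD, etaL_grad, fderiv_coneFn, sub_self]

theorem hessian_const {k : ℕ} (M : Matrix (Fin k) (Fin k) ℝ) (φ : (Fin k → ℝ) → ℝ)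
    (x u v : Fin k → ℝ) : hessian (fun _ => M) φ x u v = fderiv ℝ (fderiv ℝ φ) x u v := by
  simp [hessian, covDerivForm, christoffel, pd]

/-- Euler's identity for functions that are homogeneous of degree one. -/
theorem fderiv_apply_self_of_homogeneous {E : Type*} [NormedAddCommGroup E] [NormedSpace ℝ E]
    {f : E → ℝ} {y : E} (hf : DifferentiableAt ℝ f y)
    (hhom : ∀ t : ℝ, 0 < t → f (t • y) = t * f y) : fderiv ℝ f y y = f y := by
  have h1 : HasDerivAt (fun t : ℝ => t • y) ((1 : ℝ) • y) 1 := (hasDerivAt_id (1 : ℝ)).smul_const y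
  have h2 : HasDerivAt (fun t : ℝ => f (t • y)) (fderiv ℝ f y ((1 : ℝ) • y)) 1 :=
    HasFDerivAt.comp_hasDerivAt (1 : ℝ) (by rw [one_smul]; exact hf.hasFDerivAt) h1
  have h3 : HasDerivAt (fun t : ℝ => t * f y) (1 * f y) 1 := (hasDerivAt_id (1 : ℝ)).mul_const _
  have h4 : (fun t : ℝ => f (t • y)) =ᶠ[𝓝 1] fun t => t * f y := by
    filter_upwards [lt_mem_nhds one_pos] with t ht using hhom t ht
  simpa using h2.unique (h3.congr_of_eventuallyEq h4)

/-! ### Second derivatives along a parametrization -/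

theorem fderiv_fderiv_comp {E G : Type*} [NormedAddCommGroup E] [NormedSpace ℝ E]
    [NormedAddCommGroup G] [NormedSpace ℝ G] {φ : G → ℝ} {x : E → G} {ξ : E}
    (hφ : ContDiffAt ℝ ∞ φ (x ξ)) (hx : ContDiffAt ℝ ∞ x ξ) (a b : E) :
    fderiv ℝ (fderiv ℝ (φ ∘ x)) ξ a b =
      fderiv ℝ (fderiv ℝ φ) (x ξ) (fderiv ℝ x ξ a) (fderiv ℝ x ξ b) +
        fderiv ℝ φ (x ξ) (fderiv ℝ (fderiv ℝ x) ξ a b) := by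
  have hev : fderiv ℝ (φ ∘ x) =ᶠ[𝓝 ξ] fun ζ => (fderiv ℝ φ (x ζ)).comp (fderiv ℝ x ζ) := by
    have hφ1 : ContDiffAt ℝ 1 φ (x ξ) := hφ.of_le (by simp)
    have hx1 : ContDiffAt ℝ 1 x ξ := hx.of_le (by simp)
    filter_upwards [hx1.eventually (by simp),
      hx.continuousAt.eventually (hφ1.eventually (by simp))] with ζ h2 h3
    exact fderiv_comp ζ (h3.differentiableAt (by simp)) (h2.differentiableAt (by simp))
  have hdx : HasFDerivAt (fderiv ℝ x) (fderiv ℝ (fderiv ℝ x) ξ) ξ :=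
    ((hx.fderiv_right (m := 1) (by norm_cast)).differentiableAt (by simp)).hasFDerivAt
  have hdφ : HasFDerivAt (fun ζ => fderiv ℝ φ (x ζ))
      (fderiv ℝ (fderiv ℝ φ) (x ξ) ∘L fderiv ℝ x ξ) ξ :=
    ((hφ.fderiv_right (m := 1) (by norm_cast)).differentiableAt (by simp)).hasFDerivAt.comp ξ
      (hx.differentiableAt (by simp)).hasFDerivAt
  rw [hev.fderiv_eq, (hdφ.clm_comp hdx).fderiv]
  simp [add_comm]

/-! ### Immersed patches tangent to the orthogonal complement of a hyperbolic plane -/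

/-- In a vanishing combination, pairing with `D` isolates `β`, then pairing with `F` isolates `α`,
and injectivity of `A` does the rest. Equal dimensions turn this independence into spanning. -/
theorem exists_frame_decomposition {n : ℕ} {A : (Fin n → ℝ) →L[ℝ] (Fin (n + 2) → ℝ)}
    (hA : Function.Injective A) {D F : Fin (n + 2) → ℝ} (hDD : etaL n D D = 0)
    (hDF : etaL n D F = 1) (hDA : ∀ a, etaL n D (A a) = 0) (hFA : ∀ a, etaL n F (A a) = 0)
    (w : Fin (n + 2) → ℝ) : ∃ (b : Fin n → ℝ) (α β : ℝ), w = A b + α • D + β • F := by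
  let T : ((Fin n → ℝ) × ℝ × ℝ) →ₗ[ℝ] (Fin (n + 2) → ℝ) :=
    A.toLinearMap.coprod ((LinearMap.toSpanSingleton ℝ _ D).coprod (LinearMap.toSpanSingleton ℝ _ F))
  have hT : ∀ p, T p = A p.1 + (p.2.1 • D + p.2.2 • F) := fun p => by simp [T]
  have hinj : Function.Injective T := by
    rw [← LinearMap.ker_eq_bot, LinearMap.ker_eq_bot']
    rintro ⟨b, α, β⟩ hp
    rw [hT] at hp
    have hβ : β = 0 := by simpa [hDA, hDD, hDF] using congrArg (etaL n D) hp
    subst hβ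
    have hα : α = 0 := by simpa [hFA, etaL_comm n F D, hDF] using congrArg (etaL n F) hp
    subst hα
    have hb : A b = A 0 := by simpa using hp
    rw [hA hb]; rfl
  have hsurj : Function.Surjective T :=
    (LinearMap.injective_iff_surjective_of_finrank_eq_finrank (by simp)).1 hinj
  obtain ⟨⟨b, α, β⟩, rfl⟩ := hsurj w
  exact ⟨b, α, β, by rw [hT, add_assoc]⟩

theorem inducedMetric_apply {n : ℕ} (x : (Fin n → ℝ) → (Fin (n + 2) → ℝ)) (ξ : Fin n → ℝ)
    (i j : Fin n) : inducedMetric x ξ i j =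
      etaL n (fderiv ℝ x ξ (Pi.single i 1)) (fderiv ℝ x ξ (Pi.single j 1)) := by
  rw [etaL_apply]; rfl

theorem inducedMetric_mulVec {n : ℕ} (x : (Fin n → ℝ) → (Fin (n + 2) → ℝ)) (ξ a : Fin n → ℝ)
    (i : Fin n) : (inducedMetric x ξ).mulVec a i =
      etaL n (fderiv ℝ x ξ (Pi.single i 1)) (fderiv ℝ x ξ a) := by
  conv_rhs => rw [pi_eq_sum_univ' a]
  simp [Matrix.mulVec, dotProduct, inducedMetric_apply, mul_comm]

/-- A null vector of the Gram matrix maps to a tangent vector orthogonal to all tangent vectors and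
to `D` and `F`, hence to the whole space. -/
theorem isUnit_det_inducedMetric {n : ℕ} {x : (Fin n → ℝ) → (Fin (n + 2) → ℝ)} {ξ : Fin n → ℝ}
    (hA : Function.Injective (fderiv ℝ x ξ)) {D F : Fin (n + 2) → ℝ} (hDD : etaL n D D = 0)
    (hDF : etaL n D F = 1) (hDA : ∀ a, etaL n D (fderiv ℝ x ξ a) = 0)
    (hFA : ∀ a, etaL n F (fderiv ℝ x ξ a) = 0) : IsUnit (inducedMetric x ξ).det := by
  rw [← Matrix.isUnit_iff_isUnit_det, ← Matrix.mulVec_injective_iff_isUnit]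
  refine (injective_iff_map_eq_zero (Matrix.mulVecLin (inducedMetric x ξ))).2 fun a ha => ?_
  have h1 : ∀ b, etaL n (fderiv ℝ x ξ a) (fderiv ℝ x ξ b) = 0 := by
    intro b
    rw [pi_eq_sum_univ' b, map_sum, map_sum]
    refine Finset.sum_eq_zero fun i _ => ?_
    have h2 := congrFun ha i
    rw [Matrix.mulVecLin_apply, inducedMetric_mulVec, etaL_comm] at h2
    rw [map_smul, map_smul, h2]; simp
  have h3 : fderiv ℝ x ξ a = 0 := etaL_nondegenerate fun w => by
    obtain ⟨b, α, β, rfl⟩ := exists_frame_decomposition hA hDD hDF hDA hFA w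
    simp [h1, etaL_comm n _ D, etaL_comm n _ F, hDA, hFA]
  exact hA (by rw [h3, map_zero])

theorem pd_inducedMetric {n : ℕ} {x : (Fin n → ℝ) → (Fin (n + 2) → ℝ)} {ξ : Fin n → ℝ}
    (hx : ContDiffAt ℝ ∞ x ξ) (i j m : Fin n) :
    pd m (fun ζ => inducedMetric x ζ i j) ξ =
      etaL n (fderiv ℝ (fderiv ℝ x) ξ (Pi.single m 1) (Pi.single i 1))
          (fderiv ℝ x ξ (Pi.single j 1)) +
        etaL n (fderiv ℝ (fderiv ℝ x) ξ (Pi.single m 1) (Pi.single j 1))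
          (fderiv ℝ x ξ (Pi.single i 1)) := by
  have hdx : HasFDerivAt (fderiv ℝ x) (fderiv ℝ (fderiv ℝ x) ξ) ξ :=
    ((hx.fderiv_right (m := 1) (by norm_cast)).differentiableAt (by simp)).hasFDerivAt
  have hd (i : Fin n) := hdx.clm_apply (hasFDerivAt_const (Pi.single i (1 : ℝ) : Fin n → ℝ) ξ)
  have h := (((etaL n).hasFDerivAt.comp ξ (hd i)).clm_apply (hd j)).fderiv
  simp only [Function.comp_def] at h
  simp only [pd, inducedMetric_apply, h]
  simp [etaL_comm n (fderiv ℝ x ξ (Pi.single i 1)), add_comm]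

/-- The three metric derivatives give six terms; by symmetry of `∂²x`, four cancel and the other two
coincide, absorbing the factor `1/2`. -/
theorem christoffel_inducedMetric {n : ℕ} {x : (Fin n → ℝ) → (Fin (n + 2) → ℝ)} {ξ : Fin n → ℝ}
    (hx : ContDiffAt ℝ ∞ x ξ) (l i j : Fin n) :
    christoffel (inducedMetric x) ξ l i j = ∑ m, (inducedMetric x ξ)⁻¹ l m *
      etaL n (fderiv ℝ x ξ (Pi.single m 1))
        (fderiv ℝ (fderiv ℝ x) ξ (Pi.single i 1) (Pi.single j 1)) := by
  have hsymm : ∀ a b, fderiv ℝ (fderiv ℝ x) ξ a b = fderiv ℝ (fderiv ℝ x) ξ b a :=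
    hx.isSymmSndFDerivAt (by simp; norm_cast)
  rw [christoffel, Finset.mul_sum]
  refine Finset.sum_congr rfl fun m _ => ?_
  rw [pd_inducedMetric hx, pd_inducedMetric hx, pd_inducedMetric hx,
    hsymm (Pi.single m 1) (Pi.single i 1), hsymm (Pi.single m 1) (Pi.single j 1),
    hsymm (Pi.single j 1) (Pi.single i 1), etaL_comm n (fderiv ℝ x ξ (Pi.single m 1))]
  ring

theorem sum_christoffel_inducedMetric {n : ℕ} {x : (Fin n → ℝ) → (Fin (n + 2) → ℝ)}
    {ξ : Fin n → ℝ} (hx : ContDiffAt ℝ ∞ x ξ) (a b : Fin n → ℝ) (l : Fin n) :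
    ∑ i, ∑ j, christoffel (inducedMetric x) ξ l i j * a i * b j =
      ∑ m, (inducedMetric x ξ)⁻¹ l m *
        etaL n (fderiv ℝ x ξ (Pi.single m 1)) (fderiv ℝ (fderiv ℝ x) ξ a b) := by
  have hab : fderiv ℝ (fderiv ℝ x) ξ a b = ∑ i, ∑ j,
      (a i * b j) • fderiv ℝ (fderiv ℝ x) ξ (Pi.single i 1) (Pi.single j 1) := by
    conv_lhs => rw [pi_eq_sum_univ' a, pi_eq_sum_univ' b]
    simp only [map_sum, map_smul, sum_apply, smul_apply, Finset.smul_sum, smul_smul]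
    rw [Finset.sum_comm]
    simp only [mul_comm]
  simp only [christoffel_inducedMetric hx, hab, map_sum, map_smul, smul_eq_mul, Finset.mul_sum,
    Finset.sum_mul]
  symm
  refine Finset.sum_comm.trans (Finset.sum_congr rfl fun i _ => Finset.sum_comm.trans ?_)
  exact Finset.sum_congr rfl fun j _ => Finset.sum_congr rfl fun m _ => by ring

/-- The Levi-Civita connection of the induced metric is the tangential part of the flat one. -/
theorem hessian_inducedMetric_of_decomposition {n : ℕ} {x : (Fin n → ℝ) → (Fin (n + 2) → ℝ)}
    {ξ : Fin n → ℝ} (hx : ContDiffAt ℝ ∞ x ξ) (hdet : IsUnit (inducedMetric x ξ).det)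
    {φ : (Fin (n + 2) → ℝ) → ℝ} (hφ : ContDiffAt ℝ ∞ φ (x ξ)) {a b c : Fin n → ℝ}
    {ν : Fin (n + 2) → ℝ} (hν : ∀ v, etaL n (fderiv ℝ x ξ v) ν = 0)
    (hw : fderiv ℝ (fderiv ℝ x) ξ a b = fderiv ℝ x ξ c + ν) :
    hessian (inducedMetric x) (φ ∘ x) ξ a b =
      fderiv ℝ (fderiv ℝ φ) (x ξ) (fderiv ℝ x ξ a) (fderiv ℝ x ξ b) + fderiv ℝ φ (x ξ) ν := by
  -- The normal part `ν` drops out, leaving `g⁻¹ g c = c`.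
  have hΓ : ∀ l, ∑ i, ∑ j, christoffel (inducedMetric x) ξ l i j * a i * b j = c l := by
    intro l
    rw [sum_christoffel_inducedMetric hx, hw]
    simp only [map_add, hν, add_zero, ← inducedMetric_mulVec]
    change ((inducedMetric x ξ)⁻¹.mulVec ((inducedMetric x ξ).mulVec c)) l = c l
    rw [Matrix.mulVec_mulVec, Matrix.nonsing_inv_mul _ hdet, Matrix.one_mulVec]
  have hsum : ∑ l, ∑ i, ∑ j, christoffel (inducedMetric x) ξ l i j * a i * b j *
      fderiv ℝ (φ ∘ x) ξ (Pi.single l 1) = fderiv ℝ φ (x ξ) (fderiv ℝ x ξ c) := by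
    simp only [← Finset.sum_mul, hΓ]
    refine (sum_mul_pd (φ ∘ x) ξ c).trans ?_
    rw [fderiv_comp ξ (hφ.differentiableAt (by simp)) (hx.differentiableAt (by simp))]
    rfl
  rw [hessian, covDerivForm, hsum, fderiv_fderiv_comp hφ hx, hw, map_add]
  ring

/-! ### The submanifold `X_f` -/

theorem etaL_self_of_mem_Xf {n : ℕ} {Ω : Set (Fin (n + 2) → ℝ)} {f : (Fin (n + 2) → ℝ) → ℝ}
    {y : Fin (n + 2) → ℝ} (hy : y ∈ Xf n Ω f) : etaL n y y = 0 := by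
  have := hy.2.1
  rw [coneFn, ← etaL_apply] at this
  linarith

theorem fderiv_comp_eq_zero_of_eventually_const {E G : Type*} [NormedAddCommGroup E]
    [NormedSpace ℝ E] [NormedAddCommGroup G] [NormedSpace ℝ G] {h : G → ℝ} {x : E → G} {ξ : E}
    (hh : ContDiffAt ℝ ∞ h (x ξ)) (hx : ContDiffAt ℝ ∞ x ξ) {r : ℝ}
    (hc : ∀ᶠ ζ in 𝓝 ξ, h (x ζ) = r) (a b : E) :
    fderiv ℝ h (x ξ) (fderiv ℝ x ξ a) = 0 ∧
    fderiv ℝ h (x ξ) (fderiv ℝ (fderiv ℝ x) ξ a b) =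
      -fderiv ℝ (fderiv ℝ h) (x ξ) (fderiv ℝ x ξ a) (fderiv ℝ x ξ b) := by
  have h0 : (h ∘ x) =ᶠ[𝓝 ξ] fun _ => r := hc
  constructor
  · have h1 := fderiv_comp ξ (hh.differentiableAt (by simp)) (hx.differentiableAt (by simp))
    rw [h0.fderiv_eq] at h1
    simpa using (DFunLike.congr_fun h1 a).symm
  · have h1 := fderiv_fderiv_comp hh hx a b
    rw [h0.fderiv.fderiv_eq] at h1
    simp at h1
    linarith

theorem exists_isLocalParam_Xf {n : ℕ} {Ω : Set (Fin (n + 2) → ℝ)} (hΩ : IsOpen Ω)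
    {f : (Fin (n + 2) → ℝ) → ℝ} (hf : ContDiffOn ℝ ∞ f Ω)
    (hhom : ∀ y ∈ Ω, ∀ t : ℝ, 0 < t → f (t • y) = t * f y)
    {y : Fin (n + 2) → ℝ} (hy : y ∈ Xf n Ω f) :
    ∃ (U : Set (Fin n → ℝ)) (x : (Fin n → ℝ) → (Fin (n + 2) → ℝ)),
      IsLocalParam (Xf n Ω f) U x ∧ y ∈ x '' U := by
  have hfy : ContDiffAt ℝ ∞ f y := hf.contDiffAt (hΩ.mem_nhds hy.1)
  have hyy := etaL_self_of_mem_Xf hy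
  have hEuler : fderiv ℝ f y y = 1 := by
    rw [fderiv_apply_self_of_homogeneous (hfy.differentiableAt (by simp)) (hhom y hy.1), hy.2.2]
  have hd : fderiv ℝ (fun z => (coneFn n z, f z)) y = (etaL n y).prod (fderiv ℝ f y) :=
    ((hasFDerivAt_coneFn n y).prodMk (hfy.differentiableAt (by simp)).hasFDerivAt).fderiv
  have hyF : etaL n y (fieldF n f y) = 1 := by rw [etaL_comm, fieldF, etaL_grad, hEuler]
  have hX : Xf n Ω f = {z | z ∈ Ω ∧ (coneFn n z, f z) = (coneFn n y, f y)} := by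
    ext z
    simp [Xf, hy.2.1, hy.2.2]
  rw [hX]
  refine exists_isLocalParam_of_surjective (by simp [add_comm]) hΩ
    ((contDiff_coneFn n).contDiffOn.prodMk hf) hy.1 ?_
  rw [hd]
  rintro ⟨s, t⟩
  -- `(dc, df)` sends `y` to `(0, 1)` and `F` to `(1, df(F))`; the multiple of `y` corrects the
  -- second entry.
  refine ⟨s • fieldF n f y + (t - s * fderiv ℝ f y (fieldF n f y)) • y, ?_⟩
  simp [hyy, hyF, hEuler]

theorem isUnit_det_and_hessian_of_isLocalParam_Xf {n : ℕ} {Ω : Set (Fin (n + 2) → ℝ)}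
    (hΩ : IsOpen Ω) {f : (Fin (n + 2) → ℝ) → ℝ} (hf : ContDiffOn ℝ ∞ f Ω)
    (hhom : ∀ y ∈ Ω, ∀ t : ℝ, 0 < t → f (t • y) = t * f y)
    {U : Set (Fin n → ℝ)} {x : (Fin n → ℝ) → (Fin (n + 2) → ℝ)}
    (hx : IsLocalParam (Xf n Ω f) U x) {ξ : Fin n → ℝ} (hξ : ξ ∈ U) :
    IsUnit (inducedMetric x ξ).det ∧
    ∀ φ : (Fin (n + 2) → ℝ) → ℝ, ContDiffAt ℝ ∞ φ (x ξ) → ∀ a b : Fin n → ℝ,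
      pullback x (hessian (fun _ => etaMatrix n) φ) ξ a b =
        hessian (inducedMetric x) (φ ∘ x) ξ a b +
        pullback x
          (fun y u v => act (fieldD n) φ y * hessian (fun _ => etaMatrix n) f y u v +
            act (fieldE n f) φ y * eta n u v) ξ a b := by
  have hmem : ∀ ζ ∈ U, x ζ ∈ Xf n Ω f := by
    obtain ⟨V, -, hV⟩ := hx.image
    exact fun ζ hζ => (hV.subset (Set.mem_image_of_mem x hζ)).1
  have hU : ∀ᶠ ζ in 𝓝 ξ, ζ ∈ U := hx.isOpen.mem_nhds hξ
  have hxξ : ContDiffAt ℝ ∞ x ξ := hx.smooth.contDiffAt hU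
  have hy := hmem ξ hξ
  have hfy : ContDiffAt ℝ ∞ f (x ξ) := hf.contDiffAt (hΩ.mem_nhds hy.1)
  have hc := fderiv_comp_eq_zero_of_eventually_const (contDiff_coneFn n).contDiffAt hxξ
    (hU.mono fun ζ hζ => (hmem ζ hζ).2.1)
  have hf1 := fderiv_comp_eq_zero_of_eventually_const hfy hxξ
    (hU.mono fun ζ hζ => (hmem ζ hζ).2.2)
  simp only [fderiv_coneFn, (etaL n).fderiv] at hc
  simp only [← etaL_grad n f (x ξ)] at hf1
  set y := x ξ
  set F := grad n f y with hF
  have hDD := etaL_self_of_mem_Xf hy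
  have hDF : etaL n y F = 1 := by
    rw [etaL_comm, etaL_grad,
      fderiv_apply_self_of_homogeneous (hfy.differentiableAt (by simp)) (hhom y hy.1), hy.2.2]
  have hDA : ∀ a, etaL n y (fderiv ℝ x ξ a) = 0 := fun a => (hc a a).1
  have hFA : ∀ a, etaL n F (fderiv ℝ x ξ a) = 0 := fun a => (hf1 a a).1
  have hdet := isUnit_det_inducedMetric (hx.immersion ξ hξ) hDD hDF hDA hFA
  refine ⟨hdet, fun φ hφ a b => ?_⟩
  obtain ⟨c, α, β, hw⟩ := exists_frame_decomposition (hx.immersion ξ hξ) hDD hDF hDA hFA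
    (fderiv ℝ (fderiv ℝ x) ξ a b)
  -- Pairing `∂²x(a, b)` with `D` yields `β`, and with `F` yields `α + βF²`.
  have hβ := (hc a b).2
  have hα := (hf1 a b).2
  rw [hw] at hβ hα
  simp only [map_add, map_smul, smul_eq_mul, hDA, hFA, hDD, hDF, etaL_comm n F y] at hβ hα
  rw [hessian_inducedMetric_of_decomposition hxξ hdet hφ (ν := α • y + β • F)
    (fun v => by simp [etaL_comm n (fderiv ℝ x ξ v), hDA, hFA]) (hw.trans (add_assoc _ _ _))]
  simp only [pullback, hessian_const, act, fieldE, fieldF, fieldD_eq, ← etaL_apply,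
    map_add, map_sub, map_smul, smul_eq_mul]
  change fderiv ℝ (fderiv ℝ φ) y (fderiv ℝ x ξ a) (fderiv ℝ x ξ b) =
    fderiv ℝ (fderiv ℝ φ) y (fderiv ℝ x ξ a) (fderiv ℝ x ξ b) +
        (α * fderiv ℝ φ y y + β * fderiv ℝ φ y F) +
      (fderiv ℝ φ y y * fderiv ℝ (fderiv ℝ f) y (fderiv ℝ x ξ a) (fderiv ℝ x ξ b) +
        (f y * fderiv ℝ φ y F - etaL n F F * fderiv ℝ φ y y) *
          etaL n (fderiv ℝ x ξ a) (fderiv ℝ x ξ b))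
  have hβ' : β = -etaL n (fderiv ℝ x ξ a) (fderiv ℝ x ξ b) := by linarith
  have hα' : α = -fderiv ℝ (fderiv ℝ f) y (fderiv ℝ x ξ a) (fderiv ℝ x ξ b) - β * etaL n F F := by
    linarith
  rw [hα', hβ', hy.2.2]
  ring

end NullCone

theorem mainTheorem8 (n : ℕ) (Ω : Set (Fin (n + 2) → ℝ)) (hΩ : IsOpen Ω)
    (hcone : ∀ y ∈ Ω, ∀ t : ℝ, 0 < t → t • y ∈ Ω)
    (f : (Fin (n + 2) → ℝ) → ℝ) (hf : ContDiffOn ℝ ∞ f Ω)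
    (hhom : ∀ y ∈ Ω, ∀ t : ℝ, 0 < t → f (t • y) = t * f y) :
    (∀ y ∈ NullCone.Xf n Ω f, ∃ (U : Set (Fin n → ℝ)) (x : (Fin n → ℝ) → (Fin (n + 2) → ℝ)),
      NullCone.IsLocalParam (NullCone.Xf n Ω f) U x ∧ y ∈ x '' U) ∧
    ∀ (U : Set (Fin n → ℝ)) (x : (Fin n → ℝ) → (Fin (n + 2) → ℝ)),
      NullCone.IsLocalParam (NullCone.Xf n Ω f) U x →
      (∀ ξ ∈ U, IsUnit (NullCone.inducedMetric x ξ).det) ∧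
      ∀ (W : Set (Fin (n + 2) → ℝ)) (φ : (Fin (n + 2) → ℝ) → ℝ),
        IsOpen W → NullCone.Xf n Ω f ⊆ W → ContDiffOn ℝ ∞ φ W →
        ∀ ξ ∈ U, ∀ a b : Fin n → ℝ,
          NullCone.pullback x (NullCone.hessian (fun _ => NullCone.etaMatrix n) φ) ξ a b =
            NullCone.hessian (NullCone.inducedMetric x) (φ ∘ x) ξ a b +
            NullCone.pullback x
              (fun y u v =>
                NullCone.act (NullCone.fieldD n) φ y *
                    NullCone.hessian (fun _ => NullCone.etaMatrix n) f y u v +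
                  NullCone.act (NullCone.fieldE n f) φ y * NullCone.eta n u v) ξ a b := by
  refine ⟨fun y hy => NullCone.exists_isLocalParam_Xf hΩ hf hhom hy, fun U x hx => ⟨fun ξ hξ =>
    (NullCone.isUnit_det_and_hessian_of_isLocalParam_Xf hΩ hf hhom hx hξ).1, ?_⟩⟩
  intro W φ hW hXW hφ ξ hξ a b
  obtain ⟨V, -, hV⟩ := hx.image
  exact (NullCone.isUnit_det_and_hessian_of_isLocalParam_Xf hΩ hf hhom hx hξ).2 φ
    (hφ.contDiffAt (hW.mem_nhds (hXW (hV.subset (Set.mem_image_of_mem x hξ)).1))) a b
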